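/- A sign pattern is a square matrix with entries in $\{+,-,0\}$; products and powers are formed with the usual sign rules, where a sum containing both a $+$ and a $-$ is an ambiguous entry $\#$ (so $\#+x=\#$, $\#\cdot 0=0$, and $\#\cdot x=\#$ for $x\neq 0$). A sign pattern $A$ is sign $k$-potent if $k$ is the smallest positive integer with $A^{k+1}=A$. It allows $k$-potence if there is a real matrix $B$ with $\operatorname{sgn}(b_{ij})=a_{ij}$ for all $i,j$ and $B^{k+1}=B$. A symmetric block partition of $A$ partitions the rows and the columns into the same intervals of consecutive indices. The coarsest block partition of $A$ is the coarsest symmetric block partition for which each block has the form $\alpha J$ with $\alpha\in\{+,-,0\}$ and $J$ an all-$+$ block; the reduced block matrix $\operatorname{red}(A)$ is the sign pattern whose $(s,t)$ entry is the coefficient $\alpha_{st}$ of the $(s,t)$ block of this partition. $A$ is reducible if some simultaneous permutation of its rows and columns brings it to the form $\begin{bmatrix}A_{11}&A_{12}\\0&A_{22}\end{bmatrix}$ with nonvacuous square diagonal blocks, and irreducible otherwise. Let $P_m$ be the $m\times m$ sign pattern with $+$ on the first superdiagonal and in position $(m,1)$ and $0$ elsewhere, and let $Q_m$ be $P_m$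 with the entry in position $(m,1)$ replaced by $-$ (so $P_1=[+]$, $Q_1=[-]$). $A$ is in cyclic normal form if, for some symmetric block partition, it is block upper triangular with irreducible diagonal blocks $A_{ii}$, each of which is either a $1\times1$ zero block or satisfies $\operatorname{red}(A_{ii})\in\{P_m,Q_m\}$ for some $m\ge 1$. Theorem. Let $k\ge 1$ and let $A$ be a reducible sign $k$-potent sign pattern in cyclic normal form. Then $A$ allows $k$-potence if and only if $\operatorname{red}(A)$ allows $k$-potence. -/

import Mathlib

namespace SignPattern

/-- A (square) sign pattern of order `n`: a matrix with entries in `{+, -, 0}`. -/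
abbrev Pattern (n : ℕ) : Type := Matrix (Fin n) (Fin n) SignType

/-! ### Sign arithmetic with the ambiguous entry `#` -/

/-- The generalized signs `0, +, -, #`, where `# = (+) + (-)` is the ambiguous sign. -/
inductive GenSign : Type
  | zero
  | pos
  | neg
  | amb
  deriving DecidableEq

namespace GenSign

/-- `0` is neutral, `(+) + (+) = +`, `(-) + (-) = -`, and every other sum is ambiguous. -/
def add : GenSign → GenSign → GenSign
  | zero, b => b
  | a, zero => a
  | pos, pos => pos
  | neg, neg => neg
  | _, _ => amb

/-- `0` is absorbing, `+` is neutral, `(-)(-) = +`, and `#` times a nonzero sign is `#`. -/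
def mul : GenSign → GenSign → GenSign
  | zero, _ => zero
  | _, zero => zero
  | pos, b => b
  | a, pos => a
  | neg, neg => pos
  | _, _ => amb

instance : Zero GenSign := ⟨zero⟩

instance : Add GenSign := ⟨add⟩

/-- The generalized signs form a commutative semiring, so that powers of matrices over them
are Mathlib's. -/
instance : CommSemiring GenSign where
  mul := mul
  one := pos
  nsmul := nsmulRec
  add_assoc := by intro a b c; cases a <;> cases b <;> cases c <;> rfl
  zero_add := by intro a; cases a <;> rfl
  add_zero := by intro a; cases a <;> rfl
  add_comm := by intro a b; cases a <;> cases b <;> rfl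
  mul_assoc := by intro a b c; cases a <;> cases b <;> cases c <;> rfl
  one_mul := by intro a; cases a <;> rfl
  mul_one := by intro a; cases a <;> rfl
  zero_mul := by intro a; cases a <;> rfl
  mul_zero := by intro a; cases a <;> rfl
  mul_comm := by intro a b; cases a <;> cases b <;> rfl
  left_distrib := by intro a b c; cases a <;> cases b <;> cases c <;> rfl
  right_distrib := by intro a b c; cases a <;> cases b <;> cases c <;> rfl

/-- The unambiguous generalized signs. -/
def ofSign : SignType → GenSign
  | SignType.zero => zero
  | SignType.pos => pos
  | SignType.neg => neg

end GenSign

/-- The sign pattern `A`, read as a matrix over the generalized signs. -/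
def gen {n : ℕ} (A : Pattern n) : Matrix (Fin n) (Fin n) GenSign := A.map GenSign.ofSign

/-- `A` is sign `k`-potent: `k` is the smallest positive integer such that `A ^ (k + 1) = A`
(in particular `A ^ (k + 1)` has no ambiguous entry). -/
def IsSignKPotent {n : ℕ} (k : ℕ) (A : Pattern n) : Prop :=
  IsLeast {j : ℕ | 0 < j ∧ gen A ^ (j + 1) = gen A} k

/-! ### Qualitative class -/

/-- The qualitative class of `A`: all real matrices with sign pattern `A`. -/
def qualitativeClass {n : ℕ} (A : Pattern n) : Set (Matrix (Fin n) (Fin n) ℝ) :=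
  {B | ∀ i j, SignType.sign (B i j) = A i j}

/-- `A` allows `k`-potence: some real matrix `B` with sign pattern `A` has `B ^ (k + 1) = B`. -/
def AllowsKPotence {n : ℕ} (k : ℕ) (A : Pattern n) : Prop :=
  ∃ B ∈ qualitativeClass A, B ^ (k + 1) = B

/-! ### Block partitions and the reduced block matrix

A symmetric block partition of an `n × n` matrix cuts the rows and the columns into the same
nonempty intervals of consecutive indices, that is, it is a composition of `n`. -/

/-- Every block of `A` in the symmetric block partition `c` is of the form `α J`. -/
def IsConstantOnBlocks {n : ℕ} (A : Pattern n) (c : Composition n) : Prop :=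
  ∀ i i' j j' : Fin n, c.index i = c.index i' → c.index j = c.index j' → A i j = A i' j'

/-- `c` is a coarsest partition of `A` into blocks of the form `α J`: it is not a proper
subpartition of another one. (Coarser partitions have fewer boundaries.) -/
def IsCoarsest {n : ℕ} (A : Pattern n) (c : Composition n) : Prop :=
  MinimalFor (IsConstantOnBlocks A) Composition.boundaries c

theorem isConstantOnBlocks_ones {n : ℕ} (A : Pattern n) :
    IsConstantOnBlocks A (Composition.ones n) := by
  have key : ∀ i i' : Fin n,
      (Composition.ones n).index i = (Composition.ones n).index i' → i = i' := by
    intro i i' h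
    have h1 := (Composition.ones n).sizeUpTo_index_le i
    have h2 := (Composition.ones n).lt_sizeUpTo_index_succ i
    have h3 := (Composition.ones n).sizeUpTo_index_le i'
    have h4 := (Composition.ones n).lt_sizeUpTo_index_succ i'
    rw [← h] at h3 h4
    simp only [Composition.ones_sizeUpTo, Fin.val_succ] at h1 h2 h3 h4
    apply Fin.ext
    omega
  intro i i' j j' hi hj
  rw [key i i' hi, key j j' hj]

theorem exists_isCoarsest {n : ℕ} (A : Pattern n) : ∃ c : Composition n, IsCoarsest A c :=
  exists_minimalFor_of_wellFoundedLT _ _ ⟨_, isConstantOnBlocks_ones A⟩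

/-- The coarsest block partition of `A`. -/
noncomputable def coarsest {n : ℕ} (A : Pattern n) : Composition n := (exists_isCoarsest A).choose

/-- The number of blocks of the coarsest block partition, i.e. the order of `red A`. -/
noncomputable def redOrder {n : ℕ} (A : Pattern n) : ℕ := (coarsest A).length

/-- The reduced block matrix: its `(s, t)` entry is the common value of the entries of `A` in the
`(s, t)` block of the coarsest block partition (read off at the first entry of the block). -/
noncomputable def red {n : ℕ} (A : Pattern n) : Pattern (redOrder A) := fun s t =>
  A ((coarsest A).embedding s ⟨0, (coarsest A).one_le_blocksFun s⟩)
    ((coarsest A).embedding t ⟨0, (coarsest A).one_le_blocksFun t⟩)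

/-! ### Reducibility and normal forms -/

/-- `A` is reducible: after a simultaneous permutation of the rows and columns it has the form
`[A₁₁ A₁₂; 0 A₂₂]` with nonvacuous square `A₁₁` (of order `r`) and `A₂₂` (of order `n - r`). -/
def IsReducible {n : ℕ} (A : Pattern n) : Prop :=
  ∃ (σ : Equiv.Perm (Fin n)) (r : ℕ), 0 < r ∧ r < n ∧
    ∀ i j : Fin n, r ≤ (i : ℕ) → (j : ℕ) < r → A.submatrix σ σ i j = 0

/-- `A` is irreducible; note that every `1 × 1` pattern is irreducible. -/
def IsIrreducible {n : ℕ} (A : Pattern n) : Prop := ¬ IsReducible A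

/-- The `s`-th diagonal block of `A` in the symmetric block partition `c`. -/
def diagBlock {n : ℕ} (A : Pattern n) (c : Composition n) (s : Fin c.length) :
    Pattern (c.blocksFun s) :=
  A.submatrix (c.embedding s) (c.embedding s)

/-- `A` is in Frobenius normal form with respect to the block partition `c`: block upper
triangular with irreducible diagonal blocks (some of which may be `1 × 1` zero blocks). -/
structure IsFrobeniusNormalForm {n : ℕ} (A : Pattern n) (c : Composition n) : Prop where
  upper : ∀ i j : Fin n, c.index j < c.index i → A i j = 0
  irreducible : ∀ s : Fin c.length, IsIrreducible (diagBlock A c s)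

/-- The `m × m` pattern with `+` on the first superdiagonal, `ε` in the lower left corner and
`0` elsewhere. -/
def cyclicPattern (ε : SignType) (m : ℕ) : Pattern m := fun i j =>
  if (i : ℕ) + 1 = (j : ℕ) then 1 else if (i : ℕ) + 1 = m ∧ (j : ℕ) = 0 then ε else 0

/-- The circulant permutation pattern `P_m`. -/
def patternP (m : ℕ) : Pattern m := cyclicPattern 1 m

/-- `Q_m` is `P_m` with the `+` in the lower left corner replaced by `-`. -/
def patternQ (m : ℕ) : Pattern m := cyclicPattern (-1) m

/-- `A` is in cyclic normal form: it is in Frobenius normal form, and each diagonal block is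
either a `1 × 1` zero block or has a reduced block matrix `P_m` or `Q_m` for some `m` (which is
necessarily the order of the reduced block matrix). -/
def IsCyclicNormalForm {n : ℕ} (A : Pattern n) : Prop :=
  ∃ c : Composition n, IsFrobeniusNormalForm A c ∧
    ∀ s : Fin c.length,
      (c.blocksFun s = 1 ∧ diagBlock A c s = 0) ∨
      red (diagBlock A c s) = patternP (redOrder (diagBlock A c s)) ∨
      red (diagBlock A c s) = patternQ (redOrder (diagBlock A c s))

end SignPattern

/-! Passing from `red A` to `A` spreads each entry of a `k`-potent `R` evenly over its block: `U * R
* V` with `V * U = 1`, where `U` records block membership and `V` divides by the block sizes.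
Conversely, let `B` be `k`-potent with pattern `A`. Keeping one row per block and adding up weighted
columns gives `V * B * U`; its powers are the compressions of those of `B` as soon as `B * (U * V) *
B = B * B`. This holds if each row of `B` is a positive multiple of its representative's row, except
where the matching column of `B` vanishes and the row is never used. The proportionality is
Perron–Frobenius in nature. Since `A ^ (k + 1) = A` has no ambiguous entry, nothing cancels, so `C =
|B|` is `k`-potent too and `F = C ^ k` is a nonnegative idempotent. Two indices with equal supports
in `C` and nonzero row and column lie in one recurrent class of `F`, whose rows are proportional; `C
= F * C` carries this over to `C`, and equal signs carry it over to `B`. -/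

open Matrix

namespace SignPattern

/-! ### Nonnegative idempotent matrices -/

section Idempotent

variable {ι : Type*} [Fintype ι] {F : Matrix ι ι ℝ}

theorem mul_apply_le_of_idempotent (h0 : ∀ i j, 0 ≤ F i j) (hF : F * F = F) (i j l : ι) :
    F i j * F j l ≤ F i l := by
  conv_rhs => rw [← hF, Matrix.mul_apply]
  exact Finset.single_le_sum (f := fun j => F i j * F j l)
    (fun j _ => mul_nonneg (h0 i j) (h0 j l)) (Finset.mem_univ j)

theorem pos_trans_of_idempotent (h0 : ∀ i j, 0 ≤ F i j) (hF : F * F = F) {i j l : ι}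
    (hij : 0 < F i j) (hjl : 0 < F j l) : 0 < F i l :=
  (mul_pos hij hjl).trans_le (mul_apply_le_of_idempotent h0 hF i j l)

/-- In a nonnegative idempotent matrix, an index that is accessible from a recurrent index outside
its own class has a zero row. -/
theorem row_eq_zero_of_idempotent (h0 : ∀ i j, 0 ≤ F i j) (hF : F * F = F) {i l : ι}
    (hii : 0 < F i i) (hil : 0 < F i l) (hli : F l i = 0) (m : ι) : F l m = 0 := by
  classical
  -- The indicator of the indices from which `i` is accessible. This set is closed under
  -- predecessors, whence `hDF`.
  let d : ι → ℝ := fun j => if 0 < F j i then 1 else 0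
  have hd : ∀ j, 0 ≤ d j ∧ 0 ≤ 1 - d j := by
    intro j; by_cases h : 0 < F j i <;> simp [d, h]
  have hDF : diagonal d * F * diagonal d = F * diagonal d := by
    ext a b
    rw [mul_diagonal, diagonal_mul, mul_diagonal]
    by_cases hb : 0 < F b i
    · by_cases ha : 0 < F a i
      · simp [d, ha]
      · have : F a b = 0 := by
          by_contra h
          exact ha (pos_trans_of_idempotent h0 hF ((h0 a b).lt_of_ne' h) hb)
        simp [this]
    · simp [d, hb]
  -- With `D = diagonal d`, `hDF` gives `F D F D = F D`, so `F D F (1 - D) F = 0`. All terms are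
  -- nonnegative, so the path `i → i → l → m` has weight zero.
  have hzero : F * diagonal d * (F * (diagonal (fun j => 1 - d j) * F)) = 0 := by
    have h1 : (diagonal (fun j => 1 - d j) : Matrix ι ι ℝ) = 1 - diagonal d := by
      rw [← diagonal_one, diagonal_sub]
    have h2 : F * (diagonal d * F * diagonal d) = F * diagonal d := by
      rw [hDF, ← Matrix.mul_assoc, hF]
    have h3 : F * diagonal d * (F * (diagonal d * F)) = F * diagonal d * F := by
      conv_rhs => rw [← h2]
      simp only [Matrix.mul_assoc]
    rw [h1, Matrix.sub_mul, Matrix.one_mul, Matrix.mul_sub, hF, Matrix.mul_sub, h3, sub_self]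
  have hin : ∀ a b, 0 ≤ (F * (diagonal (fun j => 1 - d j) * F)) a b := by
    intro a b
    rw [Matrix.mul_apply]
    refine Finset.sum_nonneg fun j _ => ?_
    rw [diagonal_mul]
    exact mul_nonneg (h0 _ _) (mul_nonneg (hd j).2 (h0 _ _))
  have hsum := congrFun (congrFun hzero i) m
  rw [Matrix.mul_apply, Matrix.zero_apply, Finset.sum_eq_zero_iff_of_nonneg
    (fun j _ => mul_nonneg (by rw [mul_diagonal]; exact mul_nonneg (h0 _ _) (hd j).1) (hin _ _))]
    at hsum
  have hi := hsum i (Finset.mem_univ i)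
  have hpos : (F * diagonal d) i i ≠ 0 := by
    rw [mul_diagonal]; simp [d, hii, hii.ne']
  have hi2 := (mul_eq_zero.mp hi).resolve_left hpos
  rw [Matrix.mul_apply, Finset.sum_eq_zero_iff_of_nonneg (fun j _ => by
    rw [diagonal_mul]; exact mul_nonneg (h0 _ _) (mul_nonneg (hd j).2 (h0 _ _)))] at hi2
  have hl := hi2 l (Finset.mem_univ l)
  rw [diagonal_mul] at hl
  simpa [d, hli, hil.ne'] using hl

/-- Rows of a nonnegative idempotent matrix that belong to the same class are proportional. -/
theorem row_proportional_of_idempotent (h0 : ∀ i j, 0 ≤ F i j) (hF : F * F = F) {i j : ι}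
    (hij : 0 < F i j) (hji : 0 < F j i) : ∃ r : ℝ, 0 < r ∧ ∀ m, F j m = r * F i m := by
  have hii : 0 < F i i := pos_trans_of_idempotent h0 hF hij hji
  have hent : ∀ a b, ∑ l, F a l * F l b = F a b := fun a b => by
    rw [← Matrix.mul_apply, hF]
  refine ⟨F j i / F i i, div_pos hji hii, ?_⟩
  set r := F j i / F i i with hr
  -- The row vector `F j - r * F i` is fixed by `F`, so its absolute value `a` satisfies `a ≤ a F =
  -- b`, and `b F = b`. The ratio `r` is chosen to make `a i = 0`.
  let a : ι → ℝ := fun m => |F j m - r * F i m|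
  let b : ι → ℝ := fun m => ∑ l, a l * F l m
  have ha0 : ∀ m, 0 ≤ a m := fun m => abs_nonneg _
  have hb0 : ∀ m, 0 ≤ b m := fun m => Finset.sum_nonneg fun l _ => mul_nonneg (ha0 l) (h0 l m)
  have hab : ∀ m, a m ≤ b m := by
    intro m
    have : F j m - r * F i m = ∑ l, (F j l - r * F i l) * F l m := by
      rw [← hent j m, ← hent i m, Finset.mul_sum, ← Finset.sum_sub_distrib]
      exact Finset.sum_congr rfl fun l _ => by ring
    change |F j m - r * F i m| ≤ _
    rw [this]
    refine (Finset.abs_sum_le_sum_abs _ _).trans (le_of_eq (Finset.sum_congr rfl fun l _ => ?_))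
    rw [abs_mul, abs_of_nonneg (h0 l m)]
  have hbF : ∀ m, ∑ l, b l * F l m = b m := by
    intro m
    simp only [b, Finset.sum_mul]
    rw [Finset.sum_comm]
    refine Finset.sum_congr rfl fun p _ => ?_
    rw [← hent p m, Finset.mul_sum]
    exact Finset.sum_congr rfl fun l _ => by ring
  have hai : a i = 0 := by
    simp only [a, hr]
    rw [div_mul_cancel₀ _ hii.ne', sub_self, abs_zero]
  -- Both `a F` and `b F` equal `b`, so `(b - a) F = 0` with `b - a ≥ 0`; as `F i i > 0`, this
  -- forces `b i = a i`.
  have hbi : b i = 0 := by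
    have hs : ∑ l, (b l - a l) * F l i = 0 := by
      simp only [sub_mul, Finset.sum_sub_distrib, hbF]
      exact sub_self _
    rw [Finset.sum_eq_zero_iff_of_nonneg
      (fun l _ => mul_nonneg (sub_nonneg.mpr (hab l)) (h0 l i))] at hs
    have := (mul_eq_zero.mp (hs i (Finset.mem_univ i))).resolve_right hii.ne'
    linarith
  -- An index `l` with `b l ≠ 0` is accessible from `i` but does not lead back to it, so its row
  -- vanishes and it contributes nothing to `b F = b`.
  have hb : ∀ m, b m = 0 := by
    intro m
    rw [← hbF m]
    refine Finset.sum_eq_zero fun l _ => ?_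
    by_cases hl : b l = 0
    · rw [hl, zero_mul]
    have hli : F l i = 0 := by
      have hs := hbF i
      rw [hbi, Finset.sum_eq_zero_iff_of_nonneg (fun l _ => mul_nonneg (hb0 l) (h0 l i))] at hs
      exact (mul_eq_zero.mp (hs l (Finset.mem_univ l))).resolve_left hl
    have hil : 0 < F i l := by
      obtain ⟨p, -, hp⟩ := Finset.exists_ne_zero_of_sum_ne_zero hl
      have hpl : 0 < F p l := (h0 p l).lt_of_ne' (right_ne_zero_of_mul hp)
      have hip : 0 < F i p := by
        refine (h0 i p).lt_of_ne' fun hip => left_ne_zero_of_mul hp ?_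
        have hjp : F j p = 0 := by
          by_contra h
          exact (pos_trans_of_idempotent h0 hF hij ((h0 j p).lt_of_ne' h)).ne' hip
        simp [a, hip, hjp]
      exact pos_trans_of_idempotent h0 hF hip hpl
    rw [row_eq_zero_of_idempotent h0 hF hii hil hli m, mul_zero]
  intro m
  have : a m = 0 := le_antisymm ((hab m).trans (hb m).le) (ha0 m)
  exact sub_eq_zero.mp (abs_eq_zero.mp this)

/-- From the index of a nonzero row of a nonnegative idempotent matrix, a recurrent index is
accessible. -/
theorem exists_recurrent_of_idempotent (h0 : ∀ i j, 0 ≤ F i j) (hF : F * F = F) {i j : ι}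
    (hij : 0 < F i j) : ∃ l, 0 < F i l ∧ 0 < F l l := by
  by_contra! hno
  let T := {l : ι // 0 < F i l}
  let rel : T → T → Prop := fun x y => 0 < F x.1 y.1
  have : IsTrans T rel := ⟨fun _ _ _ h h' => pos_trans_of_idempotent h0 hF h h'⟩
  have : Std.Irrefl rel := ⟨fun x h => (hno x.1 x.2).not_gt h⟩
  have wf : WellFounded rel := Finite.wellFounded_of_trans_of_irrefl rel
  -- Without recurrent indices, accessibility is a strict order on the finite set of indices reached
  -- from `i`. Idempotence factors `i → x` as `i → l → x`, which contradicts the minimality of `x`.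
  obtain ⟨x, -, hx⟩ := wf.has_min Set.univ ⟨⟨j, hij⟩, trivial⟩
  have hne : ∑ l, F i l * F l x.1 ≠ 0 := by
    rw [← Matrix.mul_apply, hF]; exact x.2.ne'
  obtain ⟨l, -, hl⟩ := Finset.exists_ne_zero_of_sum_ne_zero hne
  exact hx ⟨l, (h0 i l).lt_of_ne' (left_ne_zero_of_mul hl)⟩ trivial
    ((h0 l x.1).lt_of_ne' (right_ne_zero_of_mul hl))

/-- An index of a nonnegative idempotent matrix with nonzero row and nonzero column is
recurrent. -/
theorem diag_pos_of_idempotent (h0 : ∀ i j, 0 ≤ F i j) (hF : F * F = F) {i j j' : ι}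
    (hij : 0 < F i j) (hji : 0 < F j' i) : 0 < F i i := by
  obtain ⟨l, hil, hll⟩ := exists_recurrent_of_idempotent h0 hF hij
  obtain ⟨m, hmi, hmm⟩ := exists_recurrent_of_idempotent (F := Fᵀ) (fun i j => h0 j i)
    (by rw [← transpose_mul, hF]) (i := i) (j := j') hji
  simp only [transpose_apply] at hmi hmm
  -- Here `m → i → l` with `m` and `l` recurrent. Row `l` is nonzero, so `l` must lead back to `m`,
  -- which closes a cycle through `i`.
  have hml := pos_trans_of_idempotent h0 hF hmi hil
  have hlm : 0 < F l m := by
    refine (h0 l m).lt_of_ne' fun h => hll.ne' ?_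
    exact row_eq_zero_of_idempotent h0 hF hmm hml h l
  exact pos_trans_of_idempotent h0 hF hil (pos_trans_of_idempotent h0 hF hlm hmi)

end Idempotent

/-! ### Nonnegative `k`-potent matrices -/

section Potent

variable {ι : Type*} [Fintype ι] {C : Matrix ι ι ℝ}

theorem pow_apply_nonneg [DecidableEq ι] (h0 : ∀ i j, 0 ≤ C i j) (m : ℕ) (i j : ι) : 0 ≤ (C ^ m) i j := by
  induction m generalizing i j with
  | zero => rw [pow_zero, Matrix.one_apply]; split_ifs <;> norm_num
  | succ m ih =>
    rw [pow_succ, Matrix.mul_apply]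
    exact Finset.sum_nonneg fun l _ => mul_nonneg (ih i l) (h0 l j)

theorem mul_apply_pos_iff {M N : Matrix ι ι ℝ} (hM : ∀ i j, 0 ≤ M i j) (hN : ∀ i j, 0 ≤ N i j)
    (i j : ι) : 0 < (M * N) i j ↔ ∃ l, 0 < M i l ∧ 0 < N l j := by
  rw [Matrix.mul_apply, Finset.sum_pos_iff_of_nonneg fun l _ => mul_nonneg (hM i l) (hN l j)]
  constructor
  · rintro ⟨l, -, hl⟩
    exact ⟨l, (hM i l).lt_of_ne' (left_ne_zero_of_mul hl.ne'),
      (hN l j).lt_of_ne' (right_ne_zero_of_mul hl.ne')⟩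
  · rintro ⟨l, h, h'⟩
    exact ⟨l, Finset.mem_univ l, mul_pos h h'⟩

/-- In a nonnegative `k`-potent matrix, two indices with the same row and column supports have
proportional rows, or zero rows, or zero columns. -/
theorem row_proportional_of_potent [DecidableEq ι] {k : ℕ} (hk : 0 < k) (h0 : ∀ i j, 0 ≤ C i j)
    (hC : C ^ (k + 1) = C) {i j : ι} (hrow : ∀ m, 0 < C i m ↔ 0 < C j m)
    (hcol : ∀ m, 0 < C m i ↔ 0 < C m j) :
    (∃ r : ℝ, 0 < r ∧ ∀ m, C j m = r * C i m) ∨ ∀ m, C m i = 0 := by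
  by_cases hci : ∀ m, C m i = 0
  · exact Or.inr hci
  left
  by_cases hri : ∀ m, C i m = 0
  · refine ⟨1, one_pos, fun m => ?_⟩
    have : ¬ 0 < C j m := by rw [← hrow, hri]; exact lt_irrefl 0
    rw [hri, mul_zero]
    exact le_antisymm (not_lt.mp this) (h0 j m)
  push Not at hci hri
  obtain ⟨p, hp⟩ := hci
  obtain ⟨q, hq⟩ := hri
  -- Writing `k = e + 1` lets `F = C ^ k` be split as `C * C ^ e` or `C ^ e * C`, even for `k = 1`.
  -- The row supports of `C` govern the first step of a path counted by `F`, the column supports the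
  -- last.
  obtain ⟨e, rfl⟩ : ∃ e, k = e + 1 := ⟨k - 1, by omega⟩
  set F := C ^ (e + 1) with hFdef
  have hF0 : ∀ i j, 0 ≤ F i j := pow_apply_nonneg h0 _
  have he0 : ∀ i j, 0 ≤ (C ^ e) i j := pow_apply_nonneg h0 _
  have hFC : F * C = C := by rw [hFdef, ← pow_succ, hC]
  have hCF : C * F = C := by rw [hFdef, ← pow_succ', hC]
  have hFl : F = C * C ^ e := pow_succ' C e
  have hFr : F = C ^ e * C := pow_succ C e
  have hFF : F * F = F := by
    calc F * F = C ^ e * (C * F) := by rw [← Matrix.mul_assoc, ← hFr]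
      _ = F := by rw [hCF, ← hFr]
  have hq' : 0 < (F * C) i q := by rw [hFC]; exact (h0 i q).lt_of_ne' hq
  have hp' : 0 < (C * F) p i := by rw [hCF]; exact (h0 p i).lt_of_ne' hp
  rw [mul_apply_pos_iff hF0 h0] at hq'
  rw [mul_apply_pos_iff h0 hF0] at hp'
  obtain ⟨q', hq', -⟩ := hq'
  obtain ⟨p', -, hp'⟩ := hp'
  have hii : 0 < F i i := diag_pos_of_idempotent hF0 hFF hq' hp'
  have hij : 0 < F i j := by
    rw [hFr, mul_apply_pos_iff he0 h0] at hii ⊢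
    obtain ⟨l, h, h'⟩ := hii
    exact ⟨l, h, (hcol l).mp h'⟩
  have hji : 0 < F j i := by
    rw [hFl, mul_apply_pos_iff h0 he0] at hii ⊢
    obtain ⟨l, h, h'⟩ := hii
    exact ⟨l, (hrow l).mp h, h'⟩
  obtain ⟨r, hr, hrF⟩ := row_proportional_of_idempotent hF0 hFF hij hji
  refine ⟨r, hr, fun m => ?_⟩
  conv_lhs => rw [← hFC, Matrix.mul_apply]
  conv_rhs => rw [← hFC, Matrix.mul_apply, Finset.mul_sum]
  exact Finset.sum_congr rfl fun l _ => by rw [hrF, mul_assoc]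

end Potent

/-! ### Generalized signs of powers -/

/-- `y` is the absolute value of `x`, and `x` has sign `g`, unless `g` is ambiguous. -/
def HasGenSign : GenSign → ℝ → ℝ → Prop
  | GenSign.zero, x, y => x = 0 ∧ y = 0
  | GenSign.pos, x, y => 0 < x ∧ y = x
  | GenSign.neg, x, y => x < 0 ∧ y = -x
  | GenSign.amb, _, _ => True

theorem HasGenSign.add {g g' : GenSign} {x x' y y' : ℝ} (h : HasGenSign g x y)
    (h' : HasGenSign g' x' y') : HasGenSign (g + g') (x + x') (y + y') := by
  change HasGenSign (GenSign.add g g') _ _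
  cases g <;> cases g' <;> simp only [HasGenSign, GenSign.add] at h h' ⊢ <;>
    constructor <;> linarith

theorem HasGenSign.mul {g g' : GenSign} {x x' y y' : ℝ} (h : HasGenSign g x y)
    (h' : HasGenSign g' x' y') : HasGenSign (g * g') (x * x') (y * y') := by
  change HasGenSign (GenSign.mul g g') _ _
  cases g <;> cases g' <;> simp only [HasGenSign, GenSign.mul] at h h' ⊢
  all_goals first
    | exact ⟨by rw [h.1, zero_mul], by rw [h.2, zero_mul]⟩
    | exact ⟨by rw [h'.1, mul_zero], by rw [h'.2, mul_zero]⟩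
    | exact ⟨by nlinarith [h.1, h'.1], by simp [h.2, h'.2]⟩

theorem HasGenSign.sum {α : Type*} (s : Finset α) {g : α → GenSign} {x y : α → ℝ}
    (h : ∀ a ∈ s, HasGenSign (g a) (x a) (y a)) :
    HasGenSign (∑ a ∈ s, g a) (∑ a ∈ s, x a) (∑ a ∈ s, y a) := by
  classical
  induction s using Finset.induction_on with
  | empty => exact ⟨Finset.sum_empty, Finset.sum_empty⟩
  | insert a s ha ih =>
    rw [Finset.sum_insert ha, Finset.sum_insert ha, Finset.sum_insert ha]
    exact (h a (Finset.mem_insert_self a s)).add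
      (ih fun b hb => h b (Finset.mem_insert_of_mem hb))

theorem hasGenSign_ofSign (x : ℝ) : HasGenSign (GenSign.ofSign (SignType.sign x)) x |x| := by
  rcases lt_trichotomy x 0 with h | rfl | h
  · rw [sign_neg h]; exact ⟨h, abs_of_neg h⟩
  · rw [sign_zero]; exact ⟨rfl, abs_zero⟩
  · rw [sign_pos h]; exact ⟨h, abs_of_pos h⟩

theorem HasGenSign.eq_abs {a : SignType} {x y : ℝ} (h : HasGenSign (GenSign.ofSign a) x y) :
    y = |x| := by
  cases a
  · obtain ⟨rfl, rfl⟩ := h; exact abs_zero.symm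
  · obtain ⟨h, rfl⟩ := h; exact (abs_of_neg h).symm
  · obtain ⟨h, rfl⟩ := h; exact (abs_of_pos h).symm

/-- An unambiguous entry of the power of `gen A` means that all nonzero terms of the corresponding
sum have the same sign, so taking absolute values commutes with the sum. Ambiguous entries carry no
information, yet `#` times zero is still zero. -/
theorem hasGenSign_pow {n : ℕ} {A : Pattern n} {B : Matrix (Fin n) (Fin n) ℝ}
    (hB : B ∈ qualitativeClass A) (m : ℕ) (i j : Fin n) :
    HasGenSign ((gen A ^ m) i j) ((B ^ m) i j) ((B.map abs ^ m) i j) := by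
  induction m generalizing i j with
  | zero =>
    rw [pow_zero, pow_zero, pow_zero, Matrix.one_apply, Matrix.one_apply]
    split_ifs
    · exact ⟨one_pos, rfl⟩
    · exact ⟨rfl, rfl⟩
  | succ m ih =>
    rw [pow_succ, pow_succ, pow_succ, Matrix.mul_apply, Matrix.mul_apply, Matrix.mul_apply]
    refine HasGenSign.sum _ fun l _ => (ih i l).mul ?_
    rw [gen, Matrix.map_apply, Matrix.map_apply, ← hB l j]
    exact hasGenSign_ofSign _

/-- If `A ^ (k + 1) = A`, there is no cancellation in the `(k + 1)`-st power of a matrix with sign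
pattern `A`. -/
theorem map_abs_pow {n k : ℕ} {A : Pattern n} {B : Matrix (Fin n) (Fin n) ℝ}
    (hA : gen A ^ (k + 1) = gen A) (hB : B ∈ qualitativeClass A) (hBk : B ^ (k + 1) = B) :
    B.map abs ^ (k + 1) = B.map abs := by
  ext i j
  have h := hasGenSign_pow hB (k + 1) i j
  rw [hA, hBk] at h
  exact h.eq_abs

/-- Indices with the same rows and columns in `A` have proportional rows in every `k`-potent real
matrix with the sign-potent pattern `A`, unless their columns vanish. -/
theorem row_proportional_of_mem_qualitativeClass {n k : ℕ} (hk : 0 < k) {A : Pattern n}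
    {B : Matrix (Fin n) (Fin n) ℝ} (hA : gen A ^ (k + 1) = gen A) (hB : B ∈ qualitativeClass A)
    (hBk : B ^ (k + 1) = B) {i j : Fin n} (hrow : ∀ m, A i m = A j m)
    (hcol : ∀ m, A m i = A m j) :
    ∃ r : ℝ, 0 < r ∧ ((∀ m, B j m = r * B i m) ∨ ∀ m, B m j = 0) := by
  have hiff : ∀ a b c d, A a b = A c d → (0 < |B a b| ↔ 0 < |B c d|) := by
    intro a b c d h
    rw [← hB a b, ← hB c d] at h
    rw [abs_pos, abs_pos, ← sign_ne_zero, h, sign_ne_zero]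
  rcases row_proportional_of_potent hk (C := B.map abs) (fun _ _ => abs_nonneg _)
    (map_abs_pow hA hB hBk) (i := i) (j := j) (fun m => hiff _ _ _ _ (hrow m))
    (fun m => hiff _ _ _ _ (hcol m)) with ⟨r, hr, h⟩ | h
  · refine ⟨r, hr, Or.inl fun m => ?_⟩
    have hs : SignType.sign (B j m) = SignType.sign (B i m) := by rw [hB, hB, hrow]
    have hm : |B j m| = r * |B i m| := h m
    rw [← sign_mul_abs (B j m), hs, hm, mul_left_comm, sign_mul_abs]
  · refine ⟨1, one_pos, Or.inr fun m => ?_⟩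
    have : B m i = 0 := abs_eq_zero.mp (h m)
    rwa [← sign_eq_zero_iff, hB, ← hcol, ← hB, sign_eq_zero_iff]

/-! ### Compression along a block partition -/

/-- Each `U * V` between consecutive factors `B` can be dropped. This serves both directions: for
expansion because the inserted product is the identity, for reduction because of row
proportionality. -/
theorem compression_pow {R ι κ : Type*} [Semiring R] [Fintype ι] [DecidableEq ι] [Fintype κ]
    [DecidableEq κ] (V : Matrix κ ι R) (B : Matrix ι ι R) (U : Matrix ι κ R)
    (h : B * (U * V) * B = B * B) (m : ℕ) :
    (V * B * U) ^ (m + 1) = V * B ^ (m + 1) * U := by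
  induction m with
  | zero => simp
  | succ m ih =>
    rw [pow_succ, ih]
    calc V * B ^ (m + 1) * U * (V * B * U) = V * B ^ m * (B * (U * V) * B) * U := by
          simp only [pow_succ, Matrix.mul_assoc]
      _ = V * B ^ (m + 1 + 1) * U := by
          rw [h]; simp only [pow_succ, Matrix.mul_assoc]

theorem sign_sum_of_forall {α : Type*} {s : Finset α} (hs : s.Nonempty) {f : α → ℝ} {a : SignType}
    (h : ∀ x ∈ s, SignType.sign (f x) = a) : SignType.sign (∑ x ∈ s, f x) = a := by
  cases a
  · exact sign_eq_zero_iff.mpr (Finset.sum_eq_zero fun x hx => sign_eq_zero_iff.mp (h x hx))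
  · exact sign_eq_neg_one_iff.mpr (Finset.sum_neg (fun x hx => sign_eq_neg_one_iff.mp (h x hx)) hs)
  · exact sign_eq_one_iff.mpr (Finset.sum_pos (fun x hx => sign_eq_one_iff.mp (h x hx)) hs)

theorem isConstantOnBlocks_coarsest {n : ℕ} (A : Pattern n) :
    IsConstantOnBlocks A (coarsest A) :=
  (exists_isCoarsest A).choose_spec.1

/-- The first index of a block of the coarsest partition. -/
noncomputable def blockRep {n : ℕ} (A : Pattern n) (s : Fin (redOrder A)) : Fin n :=
  (coarsest A).embedding s ⟨0, (coarsest A).one_le_blocksFun s⟩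

/-- The block of the coarsest partition that contains an index. -/
noncomputable def blockIndex {n : ℕ} (A : Pattern n) (i : Fin n) : Fin (redOrder A) := (coarsest A).index i

theorem blockIndex_blockRep {n : ℕ} (A : Pattern n) (s : Fin (redOrder A)) :
    blockIndex A (blockRep A s) = s :=
  (coarsest A).index_embedding s _

theorem apply_eq_of_blockIndex_eq {n : ℕ} (A : Pattern n) {i i' j j' : Fin n}
    (hi : blockIndex A i = blockIndex A i') (hj : blockIndex A j = blockIndex A j') :
    A i j = A i' j' :=
  isConstantOnBlocks_coarsest A i i' j j' hi hj

theorem red_blockIndex {n : ℕ} (A : Pattern n) (i j : Fin n) :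
    red A (blockIndex A i) (blockIndex A j) = A i j :=
  apply_eq_of_blockIndex_eq A (blockIndex_blockRep A _) (blockIndex_blockRep A _)

theorem allowsKPotence_of_red {n k : ℕ} {A : Pattern n} (h : AllowsKPotence k (red A)) :
    AllowsKPotence k A := by
  obtain ⟨R, hR, hRk⟩ := h
  let size : Fin (redOrder A) → ℝ := fun s => ({i | blockIndex A i = s} : Finset (Fin n)).card
  have hsize : ∀ s, 0 < size s := fun s =>
    Nat.cast_pos.mpr (Finset.card_pos.mpr ⟨blockRep A s, by simp [blockIndex_blockRep]⟩)
  let U : Matrix (Fin n) (Fin (redOrder A)) ℝ :=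
    Matrix.of fun i s => if blockIndex A i = s then 1 else 0
  let V : Matrix (Fin (redOrder A)) (Fin n) ℝ :=
    Matrix.of fun s i => if blockIndex A i = s then (size s)⁻¹ else 0
  have hVU : V * U = 1 := by
    ext s t
    rw [Matrix.mul_apply]
    by_cases hst : s = t
    · subst hst
      rw [Matrix.one_apply_eq]
      simp only [U, V, Matrix.of_apply, mul_ite, mul_one, mul_zero, ← ite_and, and_self]
      rw [← Finset.sum_filter, Finset.sum_const, nsmul_eq_mul]
      exact mul_inv_cancel₀ (hsize s).ne'
    · rw [Matrix.one_apply_ne hst]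
      refine Finset.sum_eq_zero fun i _ => ?_
      simp only [U, V, Matrix.of_apply]
      by_cases hi : blockIndex A i = s
      · rw [if_neg (fun h => hst (hi.symm.trans h)), mul_zero]
      · rw [if_neg hi, zero_mul]
  refine ⟨U * R * V, fun i j => ?_, ?_⟩
  · have hent : (U * R * V) i j =
        R (blockIndex A i) (blockIndex A j) * (size (blockIndex A j))⁻¹ := by
      simp [Matrix.mul_apply, U, V]
    rw [hent, sign_mul, sign_pos (inv_pos.mpr (hsize _)), mul_one, hR, red_blockIndex]
  · rw [compression_pow U R V (by rw [hVU, Matrix.mul_one]), hRk]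

theorem allowsKPotence_red {n k : ℕ} (hk : 0 < k) {A : Pattern n}
    (hA : gen A ^ (k + 1) = gen A) (h : AllowsKPotence k A) : AllowsKPotence k (red A) := by
  obtain ⟨B, hB, hBk⟩ := h
  have hprop : ∀ i, ∃ r : ℝ, 0 < r ∧
      ((∀ m, B i m = r * B (blockRep A (blockIndex A i)) m) ∨ ∀ m, B m i = 0) := fun i =>
    row_proportional_of_mem_qualitativeClass hk hA hB hBk
      (fun m => apply_eq_of_blockIndex_eq A (blockIndex_blockRep A _) rfl)
      (fun m => apply_eq_of_blockIndex_eq A rfl (blockIndex_blockRep A _))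
  choose w hw hprop using hprop
  -- `V` selects the representative rows and `U` adds the columns of each block with weights `w`.
  -- The weights are positive, so the sum keeps the common sign of its block.
  let U : Matrix (Fin n) (Fin (redOrder A)) ℝ :=
    Matrix.of fun i s => if blockIndex A i = s then w i else 0
  let V : Matrix (Fin (redOrder A)) (Fin n) ℝ :=
    Matrix.of fun s i => if blockRep A s = i then 1 else 0
  refine ⟨V * B * U, fun s t => ?_, ?_⟩
  · have hent : (V * B * U) s t =
        ∑ j with blockIndex A j = t, B (blockRep A s) j * w j := by
      rw [Matrix.mul_apply, Finset.sum_filter]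
      refine Finset.sum_congr rfl fun j _ => ?_
      simp [Matrix.mul_apply, U, V]
    rw [hent]
    refine sign_sum_of_forall ⟨blockRep A t, by simp [blockIndex_blockRep]⟩ fun j hj => ?_
    rw [sign_mul, sign_pos (hw j), mul_one, hB]
    refine apply_eq_of_blockIndex_eq A rfl ?_
    rw [(Finset.mem_filter.mp hj).2]
    exact (blockIndex_blockRep A t).symm
  · rw [compression_pow V B U ?_, hBk]
    ext a b
    rw [Matrix.mul_assoc, Matrix.mul_apply, Matrix.mul_apply]
    refine Finset.sum_congr rfl fun i _ => ?_
    -- `U * V` replaces row `i` of `B` by `w i` times its representative's row. That changes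
    -- nothing, unless column `i` of `B` is zero, and then the left factor `B` kills the term.
    have hent : (U * V * B) i b = w i * B (blockRep A (blockIndex A i)) b := by
      rw [Matrix.mul_assoc]
      simp [Matrix.mul_apply, U, V]
    rw [hent]
    rcases hprop i with h | h
    · rw [← h]
    · rw [h, zero_mul, zero_mul]

end SignPattern

theorem theorem2p5 {n k : ℕ} (A : SignPattern.Pattern n)
    (hred : SignPattern.IsReducible A)
    (hpot : SignPattern.IsSignKPotent k A)
    (hcyc : SignPattern.IsCyclicNormalForm A) :
    SignPattern.AllowsKPotence k A ↔ SignPattern.AllowsKPotence k (SignPattern.red A) :=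
  ⟨SignPattern.allowsKPotence_red hpot.1.1 hpot.1.2, SignPattern.allowsKPotence_of_red⟩
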